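/- \textbf{Candidate Deletion-Kemeny Score.} An instance consists of a finite set $C$ of $m$ candidates, a tuple $(R_1,\dots,R_n)$ of rankings (linear orders) of $C$, a ranking $X$ of $C$, a cost function $\mathrm{cost}\colon C\to\mathbb{N}$, a budget $\mathrm{bgt}\in\mathbb{N}$ and an integer $k$. The question is whether there is a set $Z\subseteq C$ with $\sum_{c\in Z}\mathrm{cost}(c)\le \mathrm{bgt}$ such that, after deleting the candidates of $Z$ from all rankings and from $X$ (keeping the relative order of the other candidates), the total Kendall tau distance satisfies $$\sum_{i=1}^{n}\mathrm{KT}\bigl(X|_{C\setminus Z},\,R_i|_{C\setminus Z}\bigr)\le k ,$$ where $\mathrm{KT}(\pi,\rho)$ is the number of unordered pairs of candidates whose relative order differs in $\pi$ and $\rho$. (For $k=0$ this says that every ranking agrees with $X$ on the remaining candidates.) \textbf{Theorem.} Candidate Deletion-Kemeny Score can be solved in polynomial time when $k=0$. More precisely, there is a random access machine (with addition, truncated subtraction, comparison and indirect addressing on registers that hold natural numbers) which, on every instance, with $C=\{0,\dots,m-1\}$ and all numbers written in binary, halts and decides correctly whether the answer for $k=0$ is yes. Its running time in the logarithmic cost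 measure, where every instruction is charged for the bit lengths of the numbers and computed addresses it handles, is bounded by a polynomial in the bit length of the input, and the same machine executes only $O(n\cdot m^2+1)$ instructions. -/

import Mathlib

/-! ### Rankings and the Kendall tau distance -/

namespace KemenyScore

/-- A ranking: a list of pairwise distinct candidates, the first entry being ranked first. -/
structure Ranking (C : Type*) where
  order : List C
  nodup : order.Nodup

namespace Ranking

variable {C : Type*} [DecidableEq C]

/-- The set `S(π)` of the candidates ranked by `π`. -/
def cands (π : Ranking C) : Finset C := π.order.toFinset

/-- `π.Before x y` means that `x` and `y` are ranked by `π` and `x` comes before `y`. -/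
def Before (π : Ranking C) (x y : C) : Prop :=
  x ∈ π.order ∧ y ∈ π.order ∧ π.order.idxOf x < π.order.idxOf y

instance (π : Ranking C) (x y : C) : Decidable (π.Before x y) := by
  unfold Before; infer_instance

/-- The ranking `π` restricted to `Y`: all candidates outside `Y` are removed and the relative
order of the others is kept. -/
def restrict (π : Ranking C) (Y : Finset C) : Ranking C where
  order := π.order.filter (fun c => decide (c ∈ Y))
  nodup := π.nodup.filter _

/-- The Kendall tau distance: the number of pairs of candidates, among those ranked by both
rankings, whose relative order differs. A disagreeing unordered pair is counted exactly once,
namely as the pair `(x, y)` with `x` before `y` in `π` and `y` before `x` in `ρ`. -/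
def kendallTau (π ρ : Ranking C) : ℕ :=
  (((π.cands ∩ ρ.cands) ×ˢ (π.cands ∩ ρ.cands)).filter
    (fun xy => π.Before xy.1 xy.2 ∧ ρ.Before xy.2 xy.1)).card

end Ranking

/-! ### Candidate Deletion-Kemeny Score -/

/-- The data of an instance, apart from the threshold `k`. The candidates are named
`0, …, numCand - 1`; `rankings` is an ordered tuple of rankings of all candidates. -/
structure CandDelInstance where
  numCand : ℕ
  rankings : List (Ranking (Fin numCand))
  target : Ranking (Fin numCand)
  cost : Fin numCand → ℕ
  budget : ℕ
  rankings_complete : ∀ R ∈ rankings, R.cands = Finset.univ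
  target_complete : target.cands = Finset.univ

namespace CandDelInstance

/-- The question of Candidate Deletion-Kemeny Score with threshold `k`: can one delete a set `Z`
of candidates of total cost at most the budget, from all the rankings and from the target, so
that the total Kendall tau distance of the target from the rankings becomes at most `k`? -/
def IsYes (I : CandDelInstance) (k : ℤ) : Prop :=
  ∃ Z : Finset (Fin I.numCand),
    ∑ c ∈ Z, I.cost c ≤ I.budget ∧
    (((I.rankings.map fun R => (I.target.restrict Zᶜ).kendallTau (R.restrict Zᶜ)).sum : ℕ) : ℤ)
      ≤ k

/-- The instance as an input word of natural numbers: the number `m` of candidates, the number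
of rankings, the budget, the `m` costs, the target as a list of `m` candidate names, and then
the rankings one after another, each as a list of `m` candidate names. -/
def encode (I : CandDelInstance) : List ℕ :=
  [I.numCand, I.rankings.length, I.budget]
    ++ List.ofFn I.cost
    ++ I.target.order.map Fin.val
    ++ I.rankings.flatMap (fun R => R.order.map Fin.val)

end CandDelInstance

end KemenyScore

/-! ### Random access machines

The machine is the usual RAM: a finite program, registers `R₀, R₁, R₂, …` that hold natural
numbers, and a read-only input word of natural numbers. The arithmetic instructions are addition
and truncated subtraction. Two complexity measures are recorded for a computation: the number of
executed instructions (uniform cost), and the logarithmic cost, in which an instruction is charged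
for the bit lengths of all the numbers and computed addresses that it handles. -/

namespace RAM

/-- The instructions. -/
inductive Instr
  /-- `Rᵢ := c` -/
  | const (i c : ℕ)
  /-- `Rᵢ := Rⱼ` -/
  | copy (i j : ℕ)
  /-- `Rᵢ := Rⱼ + Rₖ` -/
  | add (i j k : ℕ)
  /-- `Rᵢ := Rⱼ - Rₖ`, or `0` if `Rⱼ < Rₖ` -/
  | sub (i j k : ℕ)
  /-- `Rᵢ := R_{Rⱼ}` -/
  | load (i j : ℕ)
  /-- `R_{Rᵢ} := Rⱼ` -/
  | store (i j : ℕ)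
  /-- `Rᵢ :=` the input number at position `Rⱼ` (counted from `0`), or `0` beyond the input -/
  | read (i j : ℕ)
  /-- continue at instruction number `l` -/
  | jump (l : ℕ)
  /-- if `Rᵢ ≤ Rⱼ`, continue at instruction number `l` -/
  | jumpLe (i j l : ℕ)
  /-- halt and answer `b` -/
  | halt (b : Bool)

/-- A program; its instructions are numbered from `0`. -/
abbrev Program := List Instr

/-- A configuration: the number of the next instruction and the contents of the registers. -/
structure Config where
  pc : ℕ
  reg : ℕ → ℕ

/-- At the start all registers are `0`. -/
def Config.init : Config := ⟨0, fun _ => 0⟩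

/-- Go on to the next instruction after setting register `i` to `v`. -/
def Config.assign (s : Config) (i v : ℕ) : Config := ⟨s.pc + 1, Function.update s.reg i v⟩

/-- The effect of an instruction on input `x`; `none` for `halt`. -/
def Instr.exec (x : List ℕ) (s : Config) : Instr → Option Config
  | const i c => some (s.assign i c)
  | copy i j => some (s.assign i (s.reg j))
  | add i j k => some (s.assign i (s.reg j + s.reg k))
  | sub i j k => some (s.assign i (s.reg j - s.reg k))
  | load i j => some (s.assign i (s.reg (s.reg j)))
  | store i j => some (s.assign (s.reg i) (s.reg j))
  | read i j => some (s.assign i (x.getD (s.reg j) 0))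
  | jump l => some ⟨l, s.reg⟩
  | jumpLe i j l => some ⟨if s.reg i ≤ s.reg j then l else s.pc + 1, s.reg⟩
  | halt _ => none

/-- The logarithmic cost of an instruction (`Nat.size` is the bit length). -/
def Instr.logCost (x : List ℕ) (s : Config) : Instr → ℕ
  | const _ c => 1 + c.size
  | copy _ j => 1 + (s.reg j).size
  | add _ j k => 1 + (s.reg j).size + (s.reg k).size
  | sub _ j k => 1 + (s.reg j).size + (s.reg k).size
  | load _ j => 1 + (s.reg j).size + (s.reg (s.reg j)).size
  | store i j => 1 + (s.reg i).size + (s.reg j).size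
  | read _ j => 1 + (s.reg j).size + (x.getD (s.reg j) 0).size
  | jump _ => 1
  | jumpLe i j _ => 1 + (s.reg i).size + (s.reg j).size
  | halt _ => 1

/-- `HaltsFrom p x s steps time b`: the program `p` on input `x`, started in configuration `s`,
executes exactly `steps` instructions of total logarithmic cost exactly `time`, the last of
them being `halt b`. -/
inductive HaltsFrom (p : Program) (x : List ℕ) : Config → ℕ → ℕ → Bool → Prop
  | halt {s : Config} {b : Bool} :
      p[s.pc]? = some (Instr.halt b) → HaltsFrom p x s 1 1 b
  | step {s s' : Config} {c : Instr} {steps time : ℕ} {b : Bool} :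
      p[s.pc]? = some c → c.exec x s = some s' → HaltsFrom p x s' steps time b →
      HaltsFrom p x s (steps + 1) (time + c.logCost x s) b

/-- The program `p` halts on input `x` with answer `b`, after `steps` instructions of total
logarithmic cost `time`. -/
def Halts (p : Program) (x : List ℕ) (steps time : ℕ) (b : Bool) : Prop :=
  HaltsFrom p x Config.init steps time b

/-- The length of an input word: the total number of bits of its numbers, written in binary,
with one separator after each number. -/
def inputLength (x : List ℕ) : ℕ := (x.map fun a => a.size + 1).sum

end RAM

namespace RAM

/-! ### Runs of a random access machine -/

/-! For `k = 0` the set `Y` of kept candidates must be one on which every ranking agrees with the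
target. Listed in target order, it is a chain for the relation "every ranking prefers `x` to `y`".
This relation is transitive, so a heaviest chain ending at a place `j` is `j` appended to a heaviest
chain ending at some earlier place related to `j`, or `j` alone. That is the recursion
`chainWeight`; `exists_chain_iff` shows that it finds the optimum. The answer is yes iff the total
cost is at most the optimum plus the budget (`isYes_zero_iff_chainCost`).

The machine tabulates positions in order `n * m` steps, then compares order `m ^ 2` pairs of places
at up to order `n` steps each. Its correctness is proved by symbolic execution: `Reaches` composes
runs and `Reaches.loop` handles loops with invariants, against the abstract input description
`Encodes`. Runs count instructions only. The logarithmic cost is recovered afterwards from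
`HaltsFrom.time_le`, because registers grow by at most one bit per step and the number of steps is
polynomial in the input length. -/

theorem size_add_le {a b B : ℕ} (ha : a.size ≤ B) (hb : b.size ≤ B) : (a + b).size ≤ B + 1 := by
  rw [Nat.size_le] at *
  rw [pow_succ]
  omega

/-- The logarithmic cost of a computation is at most quadratic in the number of its steps: one
instruction lengthens the longest register content by at most one bit. -/
theorem HaltsFrom.time_le {p : Program} {x : List ℕ} {s : Config} {steps time : ℕ} {b : Bool}
    (h : HaltsFrom p x s steps time b) :
    ∀ {B : ℕ}, (∀ i c, Instr.const i c ∈ p → c.size ≤ B) → (∀ k, (x.getD k 0).size ≤ B) →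
      (∀ i, (s.reg i).size ≤ B) → time ≤ steps * (1 + 2 * (B + steps)) := by
  induction h with
  | halt _ => intros; nlinarith
  | @step s s' c steps time b hc he hrun ih =>
    intro B hp hx hs
    have hupd : ∀ i v : ℕ, v.size ≤ B + 1 → ∀ k, (Function.update s.reg i v k).size ≤ B + 1 := by
      intro i v hv k
      rw [Function.update_apply]
      split_ifs
      · exact hv
      · exact (hs k).trans B.le_succ
    have hmem : c ∈ p := List.mem_of_getElem? hc
    clear hrun
    have key : (∀ i, (s'.reg i).size ≤ B + 1) ∧ c.logCost x s ≤ 1 + 2 * B := by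
      cases c <;>
        simp only [Instr.exec, Option.some.injEq, reduceCtorEq] at he <;>
        subst he <;>
        simp only [Config.assign, Instr.logCost]
      case const i c => exact ⟨hupd _ _ ((hp i c hmem).trans B.le_succ), by linarith [hp i c hmem]⟩
      case copy i j => exact ⟨hupd _ _ ((hs j).trans B.le_succ), by linarith [hs j]⟩
      case add i j k => exact ⟨hupd _ _ (size_add_le (hs j) (hs k)), by linarith [hs j, hs k]⟩
      case sub i j k =>
        exact ⟨hupd _ _ (((Nat.size_le_size (Nat.sub_le _ _)).trans (hs j)).trans B.le_succ),
          by linarith [hs j, hs k]⟩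
      case load i j =>
        exact ⟨hupd _ _ ((hs _).trans B.le_succ), by linarith [hs j, hs (s.reg j)]⟩
      case store i j => exact ⟨hupd _ _ ((hs _).trans B.le_succ), by linarith [hs i, hs j]⟩
      case read i j =>
        exact ⟨hupd _ _ ((hx _).trans B.le_succ), by linarith [hs j, hx (s.reg j)]⟩
      case jump l => exact ⟨fun i => (hs i).trans B.le_succ, by linarith⟩
      case jumpLe i j l => exact ⟨fun i => (hs i).trans B.le_succ, by linarith [hs i, hs j]⟩
    -- The bit bound rises by one while the remaining number of steps falls by one, so `B + steps`
    -- is the same before and after the instruction.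
    have := ih (B := B + 1) (fun i c h => (hp i c h).trans B.le_succ)
      (fun k => (hx k).trans B.le_succ) key.1
    nlinarith [key.2]

/-- From `s` the program comes to `s'` after `k` steps. -/
def Reaches (p : Program) (x : List ℕ) (s : Config) (k : ℕ) (s' : Config) : Prop :=
  ∀ steps time b, HaltsFrom p x s' steps time b → ∃ time', HaltsFrom p x s (steps + k) time' b

namespace Reaches

variable {p : Program} {x : List ℕ}

theorem refl (s : Config) : Reaches p x s 0 s := fun _ time _ h => ⟨time, h⟩

theorem trans {s s' s'' : Config} {k k' : ℕ} (h : Reaches p x s k s')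
    (h' : Reaches p x s' k' s'') : Reaches p x s (k + k') s'' := by
  intro steps time b hb
  obtain ⟨t, ht⟩ := h' _ _ _ hb
  obtain ⟨t', ht'⟩ := h _ _ _ ht
  exact ⟨t', by rwa [show steps + (k + k') = steps + k' + k by omega]⟩

/-- Executing instructions by `rfl` leaves the final registers as a raw term; this exchanges it for
a readable one. -/
theorem of_eq {s : Config} {k pc : ℕ} {r r' : ℕ → ℕ} (h : Reaches p x s k ⟨pc, r⟩)
    (hr : r = r') : Reaches p x s k ⟨pc, r'⟩ :=
  hr ▸ h

theorem step {pc pc' k : ℕ} {r r' : ℕ → ℕ} {s : Config} {c : Instr} (hc : p[pc]? = some c)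
    (he : c.exec x ⟨pc, r⟩ = some ⟨pc', r'⟩) (h : Reaches p x ⟨pc', r'⟩ k s) :
    Reaches p x ⟨pc, r⟩ (k + 1) s := by
  intro steps time b hb
  obtain ⟨t, ht⟩ := h _ _ _ hb
  exact ⟨_, .step hc he ht⟩

theorem jumpLe_pos {pc k i j l : ℕ} {r : ℕ → ℕ} {s : Config}
    (hc : p[pc]? = some (.jumpLe i j l)) (hr : r i ≤ r j) (h : Reaches p x ⟨l, r⟩ k s) :
    Reaches p x ⟨pc, r⟩ (k + 1) s :=
  step hc (by simp [Instr.exec, hr]) h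

theorem jumpLe_neg {pc k i j l : ℕ} {r : ℕ → ℕ} {s : Config}
    (hc : p[pc]? = some (.jumpLe i j l)) (hr : r j < r i) (h : Reaches p x ⟨pc + 1, r⟩ k s) :
    Reaches p x ⟨pc, r⟩ (k + 1) s :=
  step hc (by simp [Instr.exec, hr.not_ge]) h

/-- The rule for loops: `P a r` is the invariant at the loop head `pc` after `a` rounds. -/
theorem loop {pc N c : ℕ} {P : ℕ → (ℕ → ℕ) → Prop}
    (hP : ∀ a < N, ∀ r, P a r → ∃ k r', Reaches p x ⟨pc, r⟩ k ⟨pc, r'⟩ ∧ k ≤ c ∧ P (a + 1) r')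
    {r : ℕ → ℕ} (h0 : P 0 r) :
    ∃ k r', Reaches p x ⟨pc, r⟩ k ⟨pc, r'⟩ ∧ k ≤ N * c ∧ P N r' := by
  suffices ∀ a ≤ N, ∃ k r', Reaches p x ⟨pc, r⟩ k ⟨pc, r'⟩ ∧ k ≤ a * c ∧ P a r' from this N le_rfl
  intro a
  induction a with
  | zero => exact fun _ => ⟨0, r, refl _, by simp, h0⟩
  | succ a ih =>
    intro ha
    obtain ⟨k, r', h, hk, hr'⟩ := ih (by omega)
    obtain ⟨k', r'', h', hk', hr''⟩ := hP a ha r' hr'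
    exact ⟨k + k', r'', h.trans h', by rw [add_mul]; omega, hr''⟩

end Reaches


/-! ### The program -/

/-- The program that decides Candidate Deletion-Kemeny Score with threshold `0`. The instructions
`7`-`23` tabulate the positions of the candidates in the rankings, row by row in the registers from
`20 + m` on. The instructions `24`-`60` compute, in the registers from `20` on, for every place `j`
of the target the largest total cost of a chain of candidates that ends with the one at place `j`;
a chain is a set of candidates on which all rankings agree with the target. -/
def chainProgram : Program := [
  .read 0 0, .const 3 1, .read 1 3, .const 2 2, .read 2 2, .jumpLe 0 8 64, .jumpLe 1 8 64,
  -- `7`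
  .const 4 3, .add 4 4 0, .add 5 4 0, .const 6 20, .add 6 6 0, .copy 7 6,
  -- `13`
  .jumpLe 1 8 24, .add 14 5 0,
  -- `15`
  .jumpLe 14 5 21, .read 15 5, .add 15 15 7, .store 15 5, .add 5 5 3, .jump 15,
  -- `21`
  .add 7 7 0, .add 8 8 3, .jump 13,
  -- `24`
  .const 8 0,
  -- `25`
  .jumpLe 0 8 61, .add 13 4 8, .read 13 13, .const 10 0, .const 9 0,
  -- `30`
  .jumpLe 8 9 49, .add 14 4 9, .read 14 14, .add 14 14 6, .add 15 13 6,
  -- `35`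
  .jumpLe 7 14 42, .load 16 14, .load 17 15, .jumpLe 17 16 47, .add 14 14 0, .add 15 15 0, .jump 35,
  -- `42`
  .const 16 20, .add 16 16 9, .load 16 16, .jumpLe 16 10 47, .copy 10 16,
  -- `47`
  .add 9 9 3, .jump 30,
  -- `49`
  .const 16 3, .add 16 16 13, .read 16 16, .add 10 10 16, .add 12 12 16, .const 16 20, .add 16 16 8,
  .store 16 10, .jumpLe 10 11 59, .copy 11 10,
  -- `59`
  .add 8 8 3, .jump 25,
  -- `61`
  .add 11 11 2, .jumpLe 12 11 64, .halt false,
  -- `64`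
  .halt true]

/-- `x` encodes the instance with `m` candidates, `n` rankings and budget `bgt` in which candidate
`c` costs `cost c`, the target has `cand j` at place `j`, and the entry for candidate `c` in the
ranking number `r` is the input number at position `pos r c`. -/
structure Encodes (x : List ℕ) (m n bgt : ℕ) (cand cost : ℕ → ℕ) (pos : ℕ → ℕ → ℕ) : Prop where
  numCand : x.getD 0 0 = m
  numRankings : x.getD 1 0 = n
  budget : x.getD 2 0 = bgt
  cost_eq : ∀ c < m, x.getD (3 + c) 0 = cost c
  cand_eq : ∀ j < m, x.getD (3 + m + j) 0 = cand j
  cand_lt : ∀ j < m, cand j < m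
  entry_lt : ∀ r < n, ∀ a < m, x.getD (3 + m + m + r * m + a) 0 < m
  pos_entry : ∀ r < n, ∀ a < m,
    pos r (x.getD (3 + m + m + r * m + a) 0) = 3 + m + m + r * m + a
  exists_entry : ∀ r < n, ∀ c < m, ∃ a < m, x.getD (3 + m + m + r * m + a) 0 = c

/-- The largest total weight of a chain that ends with `j`. -/
def chainWeight (ok : ℕ → ℕ → Prop) [DecidableRel ok] (w : ℕ → ℕ) (j : ℕ) : ℕ :=
  w j + (Finset.univ : Finset (Fin j)).sup
    fun i => if ok i j then chainWeight ok w i else 0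
termination_by j

/-- The definition ranges over `Fin j` so that the recursion visibly descends; the proofs use ranges
of naturals. -/
theorem chainWeight_eq (ok : ℕ → ℕ → Prop) [DecidableRel ok] (w : ℕ → ℕ) (j : ℕ) :
    chainWeight ok w j =
      w j + (Finset.range j).sup fun i => if ok i j then chainWeight ok w i else 0 := by
  rw [chainWeight]
  congr 1
  apply le_antisymm
  · exact Finset.sup_le fun i _ =>
      Finset.le_sup (f := fun i => if ok i j then chainWeight ok w i else 0)
        (Finset.mem_range.2 i.2)
  · exact Finset.sup_le fun i hi =>
      Finset.le_sup (f := fun i : Fin j => if ok i j then chainWeight ok w i else 0)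
        (Finset.mem_univ ⟨i, Finset.mem_range.1 hi⟩)

theorem row_add_lt {m n r c : ℕ} (hr : r < n) (hc : c < m) : r * m + c < n * m := by
  have : (r + 1) * m ≤ n * m := Nat.mul_le_mul_right m hr
  rw [add_mul] at this
  omega

variable {x : List ℕ} {m n bgt : ℕ} {cand cost : ℕ → ℕ} {pos : ℕ → ℕ → ℕ}

/-! ### Tabulating the positions -/

/-- The invariant after `r` complete rows and `a` entries of the next row. -/
structure TableInv (x : List ℕ) (m n bgt : ℕ) (pos : ℕ → ℕ → ℕ) (r a : ℕ) (s : ℕ → ℕ) :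
    Prop where
  r0 : s 0 = m
  r1 : s 1 = n
  r2 : s 2 = bgt
  r3 : s 3 = 1
  r4 : s 4 = 3 + m
  r5 : s 5 = 3 + m + m + r * m + a
  r6 : s 6 = 20 + m
  r7 : s 7 = 20 + m + r * m
  r8 : s 8 = r
  r11 : s 11 = 0
  r12 : s 12 = 0
  rows : ∀ r' < r, ∀ c < m, s (20 + m + r' * m + c) = pos r' c
  row : ∀ a' < a, s (20 + m + r * m + x.getD (3 + m + m + r * m + a') 0) =
    3 + m + m + r * m + a'

/-- The end of the row, in register `14`, is kept outside `TableInv`, since that invariant also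
serves the outer loop head, where register `14` is arbitrary. -/
theorem tableInv_entry (hx : Encodes x m n bgt cand cost pos) {r : ℕ} (hr : r < n) :
    ∀ a < m, ∀ s : ℕ → ℕ, TableInv x m n bgt pos r a s ∧ s 14 = 3 + m + m + r * m + m →
      ∃ k s', Reaches chainProgram x ⟨15, s⟩ k ⟨15, s'⟩ ∧ k ≤ 6 ∧
        TableInv x m n bgt pos r (a + 1) s' ∧ s' 14 = 3 + m + m + r * m + m := by
  rintro a ha s ⟨h, h14⟩
  have hlt := hx.entry_lt r hr a ha
  obtain ⟨h0, h1, h2, h3, h4, h5, h6, h7, h8, h11, h12, hrows, hrow⟩ := h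
  refine ⟨_, _, .jumpLe_neg rfl ?_ (.step rfl rfl (.step rfl rfl (.step rfl rfl (.step rfl rfl
    (.step rfl rfl (.refl _)))))), le_rfl, ?_, ?_⟩
  · rw [h5, h14]; omega
  -- The indirect store hits an address of at least `20 + m`, so the working registers survive.
  · have hlow : ∀ i < 20, i ≠ x.getD (3 + m + m + r * m + a) 0 + (20 + m + r * m) := by omega
    constructor <;> simp [Function.update_apply, h0, h1, h2, h3, h4, h5, h6, h7, h8, h11, h12,
      hlow, -List.getD_eq_getElem?_getD]
    · omega
    · intro r' hr' c hc
      have := row_add_lt hr' hc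
      rw [if_neg (by omega), if_neg (by omega), if_neg (by omega), hrows r' hr' c hc]
    · intro a' ha'
      rw [if_neg (by omega)]
      split_ifs with heq
      -- If both entries name the same candidate, then `pos r` takes one value on them, which forces
      -- `a' = a`.
      · have h1 := hx.pos_entry r hr a ha
        have h2 := hx.pos_entry r hr a' (by omega)
        rw [show x.getD (3 + m + m + r * m + a') 0 = x.getD (3 + m + m + r * m + a) 0 by omega]
          at h2
        omega
      · omega
      · refine hrow a' (lt_of_le_of_ne ha' ?_)
        rintro rfl
        exact heq (add_comm _ _)
  · have hlow : ∀ i < 20, i ≠ x.getD (3 + m + m + r * m + a) 0 + (20 + m + r * m) := by omega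
    simp [h5, h7, h14, hlow, -List.getD_eq_getElem?_getD]

theorem tableInv_row (hx : Encodes x m n bgt cand cost pos) :
    ∀ r < n, ∀ s : ℕ → ℕ, TableInv x m n bgt pos r 0 s →
      ∃ k s', Reaches chainProgram x ⟨13, s⟩ k ⟨13, s'⟩ ∧ k ≤ 6 * m + 6 ∧
        TableInv x m n bgt pos (r + 1) 0 s' := by
  intro r hr s h
  obtain ⟨k, s', hk, hle, hinv, h14⟩ := Reaches.loop (tableInv_entry hx hr)
    (r := Function.update s 14 (3 + m + m + r * m + m)) (by
      obtain ⟨h0, h1, h2, h3, h4, h5, h6, h7, h8, h11, h12, hrows, hrow⟩ := h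
      refine ⟨⟨?_, ?_, ?_, ?_, ?_, ?_, ?_, ?_, ?_, ?_, ?_, ?_, ?_⟩, ?_⟩
      all_goals simp [Function.update_apply, h0, h1, h2, h3, h4, h5, h6, h7, h8, h11, h12]
      intro r' hr' c hc
      rw [if_neg (by omega), hrows r' hr' c hc])
  have hstart : Reaches chainProgram x ⟨13, s⟩ 2
      ⟨15, Function.update s 14 (3 + m + m + r * m + m)⟩ := by
    refine .jumpLe_neg rfl ?_ (.step rfl ?_ (.refl _))
    · rw [h.r1, h.r8]; exact hr
    · simp [Instr.exec, Config.assign, h.r5, h.r0]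
  obtain ⟨h0, h1, h2, h3, h4, h5, h6, h7, h8, h11, h12, hrows, hrow⟩ := hinv
  refine ⟨_, _, (hstart.trans hk).trans (.jumpLe_pos rfl ?_ (.step rfl rfl (.step rfl rfl
    (.step rfl rfl (.refl _))))), by omega, ?_⟩
  · rw [h5, h14]
  · constructor <;> simp [Function.update_apply, h0, h1, h2, h3, h4, h5, h6, h7, h8, h11, h12]
    · ring
    · ring
    · intro r' hr' c hc
      rw [if_neg (by omega), if_neg (by omega)]
      rcases lt_or_eq_of_le hr' with hr' | rfl
      · exact hrows r' hr' c hc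
      -- The ranking is complete, so each cell of the row has been written.
      · obtain ⟨a, ha, rfl⟩ := hx.exists_entry r' hr c hc
        rw [hrow a ha, hx.pos_entry r' hr a ha]

/-- The state of the registers once the table of the positions is complete. The registers that
hold intermediate results are described separately. -/
structure Tabulated (m n bgt : ℕ) (pos : ℕ → ℕ → ℕ) (s : ℕ → ℕ) : Prop where
  r0 : s 0 = m
  r2 : s 2 = bgt
  r3 : s 3 = 1
  r4 : s 4 = 3 + m
  r6 : s 6 = 20 + m
  r7 : s 7 = 20 + m + n * m
  rows : ∀ r < n, ∀ c < m, s (20 + m + r * m + c) = pos r c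

theorem reaches_tabulated (hx : Encodes x m n bgt cand cost pos) (hm : 0 < m) (hn : 0 < n) :
    ∃ k s, Reaches chainProgram x ⟨0, fun _ => 0⟩ k ⟨25, s⟩ ∧ k ≤ n * (6 * m + 6) + 15 ∧
      Tabulated m n bgt pos s ∧ s 8 = 0 ∧ s 11 = 0 ∧ s 12 = 0 := by
  have hstart : ∃ s, Reaches chainProgram x ⟨0, fun _ => 0⟩ 13 ⟨13, s⟩ ∧
      TableInv x m n bgt pos 0 0 s := by
    refine ⟨_, .step rfl rfl (.step rfl rfl (.step rfl rfl (.step rfl rfl (.step rfl rfl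
      (.jumpLe_neg rfl ?_ (.jumpLe_neg rfl ?_ (.step rfl rfl (.step rfl rfl (.step rfl rfl
      (.step rfl rfl (.step rfl rfl (.step rfl rfl (.refl _))))))))))))), ?_⟩
    · simpa [Function.update_apply, hx.numCand, -List.getD_eq_getElem?_getD] using hm
    · simpa [Function.update_apply, hx.numRankings, -List.getD_eq_getElem?_getD] using hn
    · constructor <;> simp [Function.update_apply, hx.numCand, hx.numRankings, hx.budget,
        -List.getD_eq_getElem?_getD]
  obtain ⟨s, hs, hinv⟩ := hstart
  obtain ⟨k, s', hk, hle, hinv⟩ := Reaches.loop (tableInv_row hx) hinv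
  obtain ⟨h0, h1, h2, h3, h4, h5, h6, h7, h8, h11, h12, hrows, hrow⟩ := hinv
  refine ⟨_, _, (hs.trans hk).trans (.jumpLe_pos rfl ?_ (.step rfl rfl (.refl _))), by omega,
    ?_, ?_, ?_, ?_⟩
  · rw [h1, h8]
  · constructor <;> simp [Function.update_apply, h0, h2, h3, h4, h6, h7]
    intro r' hr' c hc
    rw [if_neg (by omega), hrows r' hr' c hc]
  · simp
  · simp [h11]
  · simp [h12]

/-- Registers `8` to `19` are scratch space and the chain costs occupy `20` to `19 + m`; neither
block matters for the table. -/
theorem Tabulated.congr {s s' : ℕ → ℕ} (h : Tabulated m n bgt pos s)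
    (h₁ : ∀ i < 8, s' i = s i) (h₂ : ∀ i, 20 + m ≤ i → s' i = s i) :
    Tabulated m n bgt pos s' where
  r0 := (h₁ 0 (by omega)).trans h.r0
  r2 := (h₁ 2 (by omega)).trans h.r2
  r3 := (h₁ 3 (by omega)).trans h.r3
  r4 := (h₁ 4 (by omega)).trans h.r4
  r6 := (h₁ 6 (by omega)).trans h.r6
  r7 := (h₁ 7 (by omega)).trans h.r7
  rows r hr c hc := (h₂ _ (by omega)).trans (h.rows r hr c hc)

/-! ### Comparing candidates and computing the chain costs -/

/-- The loop `35`-`41` compares the candidates `c` and `d` in all rankings from number `r` on. -/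
theorem reaches_compare {c d : ℕ} (hc : c < m) (hd : d < m) (l : ℕ) :
    ∀ r, r + l = n → ∀ s, Tabulated m n bgt pos s →
      s 14 = 20 + m + r * m + c → s 15 = 20 + m + r * m + d →
      ∃ k s' pc, Reaches chainProgram x ⟨35, s⟩ k ⟨pc, s'⟩ ∧ k ≤ 7 * l + 1 ∧
        (∀ i, i < 14 ∨ 18 ≤ i → s' i = s i) ∧
        (pc = 42 ∧ (∀ r' < n, r ≤ r' → pos r' c < pos r' d) ∨
          pc = 47 ∧ ∃ r' < n, ¬ pos r' c < pos r' d) := by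
  induction l with
  | zero =>
    rintro r rfl s h h14 h15
    -- With no ranking left, the cell address has passed the end of the table, so the exit test
    -- succeeds.
    refine ⟨_, s, 42, .jumpLe_pos rfl ?_ (.refl _), by omega, fun _ _ => rfl,
      .inl ⟨rfl, fun r' h h' => by omega⟩⟩
    rw [h.r7, h14]
    simp only [add_zero]
    omega
  | succ l ih =>
    intro r hr s h h14 h15
    have hrn : r < n := by omega
    have hlt := row_add_lt hrn hc
    have hload : Reaches chainProgram x ⟨35, s⟩ 3
        ⟨38, Function.update (Function.update s 16 (pos r c)) 17 (pos r d)⟩ := by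
      refine .of_eq (.jumpLe_neg rfl ?_ (.step rfl rfl (.step rfl rfl (.refl _)))) ?_
      · rw [h.r7, h14]; omega
      · simp only [h14, h.rows r hrn c hc]
        congr 1
        have h15' : Function.update s 16 (pos r c) 15 = 20 + m + r * m + d := by simp [h15]
        rw [h15', Function.update_of_ne (by omega), h.rows r hrn d hd]
    by_cases hcd : pos r c < pos r d
    · obtain ⟨k, s', pc, hk, hle, hframe, hpc⟩ := ih (r + 1) (by omega)
        (Function.update (Function.update (Function.update (Function.update s 16 (pos r c))
          17 (pos r d)) 14 (20 + m + (r + 1) * m + c)) 15 (20 + m + (r + 1) * m + d))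
        (h.congr (fun i hi => by
            repeat rw [Function.update_of_ne (by omega)])
          fun i hi => by repeat rw [Function.update_of_ne (by omega)])
        (by simp) (by simp)
      refine ⟨_, s', pc, hload.trans (.trans (k := 4) (.of_eq (.jumpLe_neg rfl ?_ (.step rfl rfl
        (.step rfl rfl (.step rfl rfl (.refl _))))) ?_) hk), by omega, ?_, ?_⟩
      · simpa using hcd
      · simp [h.r0, h14, h15, add_mul, add_assoc, add_comm m]
      · intro i hi
        rw [hframe i hi]
        repeat rw [Function.update_of_ne (by omega)]
      · refine hpc.imp_left fun ⟨h1, h2⟩ => ⟨h1, fun r' hr' hle => ?_⟩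
        rcases eq_or_lt_of_le hle with rfl | hlt
        · exact hcd
        · exact h2 r' hr' hlt
    · refine ⟨_, _, 47, hload.trans (.jumpLe_pos rfl ?_ (.refl _)), by omega, ?_,
        .inr ⟨rfl, r, hrn, hcd⟩⟩
      · simpa using hcd
      · intro i hi
        repeat rw [Function.update_of_ne (by omega)]

/-- All rankings prefer the candidate at place `i` of the target to the one at place `j`. -/
abbrev AllPrefer (n : ℕ) (cand : ℕ → ℕ) (pos : ℕ → ℕ → ℕ) (i j : ℕ) : Prop :=
  ∀ r < n, pos r (cand i) < pos r (cand j)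

/-- The largest cost of a chain that ends at place `j` of the target. -/
abbrev chainCost (n : ℕ) (cand cost : ℕ → ℕ) (pos : ℕ → ℕ → ℕ) (j : ℕ) : ℕ :=
  chainWeight (AllPrefer n cand pos) (fun i => cost (cand i)) j

/-- The largest cost of a chain that ends before place `i` and can be continued with place `j`. -/
abbrev prefixCost (n : ℕ) (cand cost : ℕ → ℕ) (pos : ℕ → ℕ → ℕ) (j i : ℕ) : ℕ :=
  (Finset.range i).sup fun i => if AllPrefer n cand pos i j then chainCost n cand cost pos i else 0

/-- The invariant of the loop `30`-`48`. -/
structure PrefixInv (m n bgt : ℕ) (cand cost : ℕ → ℕ) (pos : ℕ → ℕ → ℕ) (j M t i : ℕ)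
    (s : ℕ → ℕ) : Prop where
  tab : Tabulated m n bgt pos s
  r8 : s 8 = j
  r9 : s 9 = i
  r10 : s 10 = prefixCost n cand cost pos j i
  r11 : s 11 = M
  r12 : s 12 = t
  r13 : s 13 = cand j
  chains : ∀ i < j, s (20 + i) = chainCost n cand cost pos i

/-- A round has three outcomes: the comparison fails, the stored chain cost is no improvement, or it
becomes the new maximum. All of them meet at instruction `47`, hence the shared `hlast`. The longest
takes `5 + (7 * n + 1) + 3 + 2 + 2` steps. -/
theorem prefixInv_step (hx : Encodes x m n bgt cand cost pos) {j M t : ℕ} (hj : j < m) :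
    ∀ i < j, ∀ s, PrefixInv m n bgt cand cost pos j M t i s →
      ∃ k s', Reaches chainProgram x ⟨30, s⟩ k ⟨30, s'⟩ ∧ k ≤ 7 * n + 13 ∧
        PrefixInv m n bgt cand cost pos j M t (i + 1) s' := by
  rintro i hi s ⟨htab, h8, h9, h10, h11, h12, h13, hch⟩
  obtain ⟨k, s', pc, hk, hle, hframe, hpc⟩ := reaches_compare (x := x)
    (hx.cand_lt i (hi.trans hj)) (hx.cand_lt j hj) n 0 (zero_add n)
    (Function.update (Function.update s 14 (20 + m + 0 * m + cand i))
      15 (20 + m + 0 * m + cand j))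
    (htab.congr (fun i hi => by repeat rw [Function.update_of_ne (by omega)])
      fun i hi => by repeat rw [Function.update_of_ne (by omega)])
    (by simp) (by simp)
  replace hframe : ∀ a, a < 14 ∨ 18 ≤ a → s' a = s a := fun a ha => by
    rw [hframe a ha]
    repeat rw [Function.update_of_ne (by omega)]
  have hstart : Reaches chainProgram x ⟨30, s⟩ 5 ⟨35,
      Function.update (Function.update s 14 (20 + m + 0 * m + cand i))
        15 (20 + m + 0 * m + cand j)⟩ := by
    refine .of_eq (.jumpLe_neg rfl ?_ (.step rfl rfl (.step rfl rfl (.step rfl rfl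
      (.step rfl rfl (.refl _)))))) ?_
    · rw [h8, h9]; exact hi
    · simp [htab.r4, htab.r6, h9, h13, add_comm (cand _),
        hx.cand_eq i (hi.trans hj), -List.getD_eq_getElem?_getD]
  have hsucc : prefixCost n cand cost pos j (i + 1) = max (prefixCost n cand cost pos j i)
      (if AllPrefer n cand pos i j then chainCost n cand cost pos i else 0) := by
    rw [prefixCost, Finset.range_add_one, Finset.sup_insert, sup_comm]
  -- the last two instructions of the loop body
  have hlast : ∀ s'' : ℕ → ℕ, (∀ a, a < 14 ∧ a ≠ 10 ∨ 18 ≤ a → s'' a = s a) →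
      s'' 10 = prefixCost n cand cost pos j (i + 1) →
      ∃ s₃, Reaches chainProgram x ⟨47, s''⟩ 2 ⟨30, s₃⟩ ∧
        PrefixInv m n bgt cand cost pos j M t (i + 1) s₃ := by
    intro s'' hf h10'
    refine ⟨Function.update s'' 9 (i + 1), .of_eq (.step rfl rfl (.step rfl rfl (.refl _))) ?_, ?_⟩
    · simp [hf 9, hf 3, h9, htab.r3]
    · refine ⟨htab.congr (fun a ha => ?_) (fun a ha => ?_), ?_, ?_, ?_, ?_, ?_, ?_, fun a ha => ?_⟩
      · rw [Function.update_of_ne (by omega), hf a (by omega)]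
      · rw [Function.update_of_ne (by omega), hf a (by omega)]
      all_goals simp [Function.update_apply, *]
      rw [if_neg (by omega), hf _ (by omega), hch a ha]
  rcases hpc with ⟨rfl, hok⟩ | ⟨rfl, hnok⟩
  · replace hok : AllPrefer n cand pos i j := fun r hr => hok r hr (Nat.zero_le _)
    rw [if_pos hok] at hsucc
    have hload : Reaches chainProgram x ⟨42, s'⟩ 3
        ⟨45, Function.update s' 16 (chainCost n cand cost pos i)⟩ := by
      refine .of_eq (.step rfl rfl (.step rfl rfl (.step rfl rfl (.refl _)))) ?_
      have h20 : Function.update s' 16 (20 + i) (20 + i) = chainCost n cand cost pos i := by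
        rw [Function.update_of_ne (by omega), hframe _ (by omega), hch i hi]
      simp [hframe 9, h9, h20]
    by_cases hmax : chainCost n cand cost pos i ≤ prefixCost n cand cost pos j i
    · obtain ⟨s₃, hr, hs₃⟩ := hlast (Function.update s' 16 (chainCost n cand cost pos i))
        (fun a ha => by rw [Function.update_of_ne (by omega), hframe a (by omega)])
        (by simp [hframe 10, h10, hsucc, hmax])
      exact ⟨_, s₃, ((hstart.trans hk).trans hload).trans (.jumpLe_pos rfl
        (by simpa [hframe 10, h10] using hmax) hr), by omega, hs₃⟩
    · obtain ⟨s₃, hr, hs₃⟩ := hlast (Function.update (Function.update s' 16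
          (chainCost n cand cost pos i)) 10 (chainCost n cand cost pos i))
        (fun a ha => by
          rw [Function.update_of_ne (by omega), Function.update_of_ne (by omega),
            hframe a (by omega)])
        (by simp [hsucc, (not_le.1 hmax).le])
      exact ⟨_, s₃, ((hstart.trans hk).trans hload).trans (.jumpLe_neg rfl
        (by simpa [hframe 10, h10] using hmax) (.step rfl (by simp [Instr.exec, Config.assign]) hr)),
        by omega, hs₃⟩
  · rw [if_neg (by simpa using hnok)] at hsucc
    obtain ⟨s₃, hr, hs₃⟩ := hlast s' (fun a ha => hframe a (by omega))
      (by simp [hframe 10, h10, hsucc])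
    exact ⟨_, s₃, (hstart.trans hk).trans hr, by omega, hs₃⟩

/-- The invariant of the loop `25`-`60`. -/
structure ChainInv (m n bgt : ℕ) (cand cost : ℕ → ℕ) (pos : ℕ → ℕ → ℕ) (j : ℕ)
    (s : ℕ → ℕ) : Prop where
  tab : Tabulated m n bgt pos s
  r8 : s 8 = j
  r11 : s 11 = (Finset.range j).sup (chainCost n cand cost pos)
  r12 : s 12 = ∑ i ∈ Finset.range j, cost (cand i)
  chains : ∀ i < j, s (20 + i) = chainCost n cand cost pos i

theorem chainInv_step (hx : Encodes x m n bgt cand cost pos) :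
    ∀ j < m, ∀ s, ChainInv m n bgt cand cost pos j s →
      ∃ k s', Reaches chainProgram x ⟨25, s⟩ k ⟨25, s'⟩ ∧ k ≤ m * (7 * n + 13) + 18 ∧
        ChainInv m n bgt cand cost pos (j + 1) s' := by
  rintro j hj s ⟨htab, h8, h11, h12, hch⟩
  have hstart : Reaches chainProgram x ⟨25, s⟩ 5 ⟨30,
      Function.update (Function.update (Function.update s 13 (cand j)) 10 0) 9 0⟩ := by
    refine .of_eq (.jumpLe_neg rfl ?_ (.step rfl rfl (.step rfl rfl (.step rfl rfl
      (.step rfl rfl (.refl _)))))) ?_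
    · rw [htab.r0, h8]; exact hj
    · simp [htab.r4, h8, hx.cand_eq j hj, -List.getD_eq_getElem?_getD]
  obtain ⟨k, s', hk, hle, htab', h8', h9', h10', h11', h12', h13', hch'⟩ :=
    Reaches.loop (prefixInv_step hx (M := (Finset.range j).sup (chainCost n cand cost pos))
      (t := ∑ i ∈ Finset.range j, cost (cand i)) hj)
    (r := Function.update (Function.update (Function.update s 13 (cand j)) 10 0) 9 0) (by
      refine ⟨htab.congr (fun a ha => ?_) (fun a ha => ?_), ?_, ?_, ?_, ?_, ?_, ?_, fun a ha => ?_⟩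
      · repeat rw [Function.update_of_ne (by omega)]
      · repeat rw [Function.update_of_ne (by omega)]
      rotate_right
      · repeat rw [Function.update_of_ne (by omega)]
        exact hch a ha
      all_goals simp [h8, h11, h12, prefixCost])
  replace hle : k ≤ m * (7 * n + 13) := hle.trans (Nat.mul_le_mul_right _ hj.le)
  -- By the recursion, the maximum left by the inner loop plus the cost of the candidate at place
  -- `j` is the value to be stored.
  have hW : chainCost n cand cost pos j = cost (cand j) + prefixCost n cand cost pos j j :=
    chainWeight_eq _ _ _
  set W := chainCost n cand cost pos j with hWdef
  have hsup : (Finset.range (j + 1)).sup (chainCost n cand cost pos) =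
      max ((Finset.range j).sup (chainCost n cand cost pos)) W := by
    rw [Finset.range_add_one, Finset.sup_insert, sup_comm]
  have hbody : ∃ s'', Reaches chainProgram x ⟨30, s'⟩ 9 ⟨57, s''⟩ ∧
      (∀ a, a ≠ 10 ∧ a ≠ 11 ∧ a ≠ 12 ∧ a ≠ 16 ∧ a ≠ 20 + j → s'' a = s' a) ∧ s'' 10 = W ∧
      s'' 11 = s' 11 ∧ s'' 12 = ∑ i ∈ Finset.range (j + 1), cost (cand i) ∧ s'' (20 + j) = W := by
    refine ⟨_, .jumpLe_pos rfl ?_ (.step rfl rfl (.step rfl rfl (.step rfl rfl (.step rfl rfl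
      (.step rfl rfl (.step rfl rfl (.step rfl rfl (.step rfl rfl (.refl _))))))))), fun a ha => ?_,
      ?_⟩
    · rw [h8', h9']
    · simp [h8', ha]
    · have hlow : ∀ a < 20, a ≠ 20 + j := by omega
      simp [h8', h10', h12', h13', hlow, hW, Finset.sum_range_succ,
        add_comm (cost _), hx.cost_eq _ (hx.cand_lt j hj), -List.getD_eq_getElem?_getD]
  have hlast : ∀ s'' : ℕ → ℕ,
      (∀ a, a ≠ 10 ∧ a ≠ 11 ∧ a ≠ 12 ∧ a ≠ 16 ∧ a ≠ 20 + j → s'' a = s' a) →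
      s'' 11 = (Finset.range (j + 1)).sup (chainCost n cand cost pos) →
      s'' 12 = ∑ i ∈ Finset.range (j + 1), cost (cand i) → s'' (20 + j) = W →
      ∃ s₃, Reaches chainProgram x ⟨59, s''⟩ 2 ⟨25, s₃⟩ ∧
        ChainInv m n bgt cand cost pos (j + 1) s₃ := by
    intro s'' hf h1 h2 h3
    refine ⟨Function.update s'' 8 (j + 1), .of_eq (.step rfl rfl (.step rfl rfl (.refl _))) ?_, ?_⟩
    · simp [hf 8 (by omega), hf 3 (by omega), h8', htab'.r3]
    · refine ⟨htab'.congr (fun a ha => ?_) (fun a ha => ?_), ?_, ?_, ?_, fun a ha => ?_⟩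
      · rw [Function.update_of_ne (by omega), hf a (by omega)]
      -- As `j < m`, the cell `20 + j` lies below the table.
      · rw [Function.update_of_ne (by omega), hf a (by omega)]
      · simp
      · simpa using h1
      · simpa using h2
      · rw [Function.update_of_ne (by omega)]
        rcases Nat.lt_succ_iff_lt_or_eq.1 ha with ha | rfl
        · rw [hf _ (by omega), hch' a ha]
        · exact h3
  obtain ⟨s₁, hs₁, hf, h10₁, h11₁, h12₁, h20₁⟩ := hbody
  by_cases hmax : W ≤ (Finset.range j).sup (chainCost n cand cost pos)
  · obtain ⟨s₃, hr, hs₃⟩ := hlast s₁ hf (by rw [h11₁, h11', hsup, max_eq_left hmax]) h12₁ h20₁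
    exact ⟨_, s₃, ((hstart.trans hk).trans hs₁).trans (.jumpLe_pos rfl
      (by simpa [h10₁, h11₁, h11'] using hmax) hr), by omega, hs₃⟩
  · obtain ⟨s₃, hr, hs₃⟩ := hlast (Function.update s₁ 11 W)
      (fun a ha => by rw [Function.update_of_ne (by omega), hf a ha])
      (by rw [Function.update_self, hsup, max_eq_right (not_le.1 hmax).le])
      (by rw [Function.update_of_ne (by omega), h12₁])
      (by rw [Function.update_of_ne (by omega), h20₁])
    exact ⟨_, s₃, ((hstart.trans hk).trans hs₁).trans (.jumpLe_neg rfl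
      (by simpa [h10₁, h11₁, h11'] using hmax) (.step rfl
      (by simp [Instr.exec, Config.assign, h10₁]) hr)), by omega, hs₃⟩

theorem reaches_chains (hx : Encodes x m n bgt cand cost pos) (hm : 0 < m) (hn : 0 < n) :
    ∃ k s, Reaches chainProgram x Config.init k ⟨61, s⟩ ∧
      k ≤ n * (6 * m + 6) + 15 + m * (m * (7 * n + 13) + 18) + 1 ∧
      ChainInv m n bgt cand cost pos m s := by
  obtain ⟨k, s, hk, hle, htab, h8, h11, h12⟩ := reaches_tabulated hx hm hn
  obtain ⟨k', s', hk', hle', hinv⟩ := Reaches.loop (chainInv_step hx) (r := s)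
    ⟨htab, h8, by simpa using h11, by simpa using h12, by simp⟩
  refine ⟨_, s', (hk.trans hk').trans (.jumpLe_pos rfl ?_ (.refl _)), by omega, hinv⟩
  rw [hinv.tab.r0, hinv.r8]

theorem Reaches.halts {p : Program} {k pc : ℕ} {s : Config} {r : ℕ → ℕ} {b : Bool}
    (h : Reaches p x s k ⟨pc, r⟩) (hb : p[pc]? = some (.halt b)) :
    ∃ time, HaltsFrom p x s (1 + k) time b :=
  h 1 1 b (.halt hb)

/-! ### Answer and instruction count -/

/-- The answer of `chainProgram` and the number of its steps. -/
theorem halts_chainProgram (hx : Encodes x m n bgt cand cost pos) :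
    ∃ steps time answer, Halts chainProgram x steps time answer ∧
      steps ≤ 100 * (n * m ^ 2 + 1) ∧
      (answer = true ↔ m = 0 ∨ n = 0 ∨ ∑ i ∈ Finset.range m, cost (cand i) ≤
        (Finset.range m).sup (chainCost n cand cost pos) + bgt) := by
  -- The early exits are needed for the step bound: without them, `m = 0` would still cost order `n`
  -- steps and `n = 0` order `m ^ 2`.
  by_cases hm : m = 0
  · have : Reaches chainProgram x Config.init 6 ⟨64, _⟩ :=
      .step rfl rfl (.step rfl rfl (.step rfl rfl (.step rfl rfl (.step rfl rfl
        (.jumpLe_pos rfl (by simp [hx.numCand, hm,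
          -List.getD_eq_getElem?_getD]) (.refl _))))))
    obtain ⟨time, h⟩ := this.halts rfl
    exact ⟨_, time, true, h, by omega, by simp [hm]⟩
  by_cases hn : n = 0
  · have : Reaches chainProgram x Config.init 7 ⟨64, _⟩ :=
      .step rfl rfl (.step rfl rfl (.step rfl rfl (.step rfl rfl (.step rfl rfl
        (.jumpLe_neg rfl (by simp [hx.numCand,
          Nat.pos_of_ne_zero hm, -List.getD_eq_getElem?_getD])
        (.jumpLe_pos rfl (by simp [hx.numRankings, hn, -List.getD_eq_getElem?_getD]) (.refl _)))))))
    obtain ⟨time, h⟩ := this.halts rfl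
    exact ⟨_, time, true, h, by omega, by simp [hn]⟩
  obtain ⟨k, s, hk, hle, hinv⟩ :=
    reaches_chains hx (Nat.pos_of_ne_zero hm) (Nat.pos_of_ne_zero hn)
  -- As `m` and `n` are positive, each monomial is at most `n * m ^ 2`; the coefficients add up to
  -- `66`.
  have hsteps : k ≤ 80 * (n * m ^ 2) := by
    have h1 : 1 ≤ m := Nat.pos_of_ne_zero hm
    have h2 : 1 ≤ n := Nat.pos_of_ne_zero hn
    have e1 : n * m ≤ n * m ^ 2 := Nat.mul_le_mul_left n (Nat.le_self_pow two_ne_zero m)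
    have e2 : n ≤ n * m := Nat.le_mul_of_pos_right n h1
    have e3 : m ^ 2 ≤ n * m ^ 2 := Nat.le_mul_of_pos_left _ h2
    have e4 : m ≤ m ^ 2 := Nat.le_self_pow two_ne_zero m
    have e5 : n * (6 * m + 6) + 15 + m * (m * (7 * n + 13) + 18) + 1 =
      6 * (n * m) + 6 * n + 16 + 7 * (n * m ^ 2) + 13 * m ^ 2 + 18 * m := by ring
    omega
  have hadd : Reaches chainProgram x ⟨61, s⟩ 1 ⟨62, Function.update s 11
      ((Finset.range m).sup (chainCost n cand cost pos) + bgt)⟩ :=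
    .of_eq (.step rfl rfl (.refl _)) (by simp [hinv.r11, hinv.tab.r2])
  by_cases hans : ∑ i ∈ Finset.range m, cost (cand i) ≤
      (Finset.range m).sup (chainCost n cand cost pos) + bgt
  · obtain ⟨time, h⟩ := ((hk.trans hadd).trans (.jumpLe_pos rfl
      (by simpa [hinv.r12] using hans) (.refl _))).halts rfl
    exact ⟨_, time, true, h, by omega, by simp [hans]⟩
  · obtain ⟨time, h⟩ := ((hk.trans hadd).trans (.jumpLe_neg rfl
      (by simpa [hinv.r12] using hans) (.refl _))).halts rfl
    exact ⟨_, time, false, h, by omega, by simp [hans, hm, hn]⟩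


/-! ### Heaviest chains -/

section chainWeight

variable {ok : ℕ → ℕ → Prop} [DecidableRel ok] {w : ℕ → ℕ}

/-- The recursion tests only the last element `i` of a chain against `j`; transitivity extends this
to all earlier elements. -/
theorem exists_sum_eq_chainWeight (htrans : ∀ i j k, ok i j → ok j k → ok i k) (j : ℕ) :
    ∃ K : Finset ℕ, j ∈ K ∧ (∀ i ∈ K, i ≤ j) ∧ (∀ i ∈ K, ∀ i' ∈ K, i < i' → ok i i') ∧
      ∑ i ∈ K, w i = chainWeight ok w j := by
  induction j using Nat.strong_induction_on with
  | _ j ih =>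
  rw [chainWeight_eq]
  have hsingle : ∃ K : Finset ℕ, j ∈ K ∧ (∀ i ∈ K, i ≤ j) ∧
      (∀ i ∈ K, ∀ i' ∈ K, i < i' → ok i i') ∧ ∑ i ∈ K, w i = w j + 0 :=
    ⟨{j}, by simp⟩
  rcases (Finset.range j).eq_empty_or_nonempty with he | hne
  · simpa only [he, Finset.sup_empty, Nat.bot_eq_zero] using hsingle
  obtain ⟨i, hi, hsup⟩ := Finset.exists_mem_eq_sup _ hne
    fun i => if ok i j then chainWeight ok w i else 0
  rw [Finset.mem_range] at hi
  rw [hsup]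
  split_ifs with hok
  · obtain ⟨K, hiK, hle, hK, hsum⟩ := ih i hi
    have hj : j ∉ K := fun h => by have := hle j h; omega
    have hokj : ∀ a ∈ K, ok a j := fun a ha => by
      rcases eq_or_lt_of_le (hle a ha) with rfl | hlt
      · exact hok
      · exact htrans _ _ _ (hK a ha i hiK hlt) hok
    refine ⟨insert j K, Finset.mem_insert_self _ _, ?_, ?_, ?_⟩
    · intro a ha
      rcases Finset.mem_insert.1 ha with rfl | ha
      · exact le_rfl
      · exact (hle a ha).trans hi.le
    · intro a ha b hb hab
      rcases Finset.mem_insert.1 ha with rfl | haK <;>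
        rcases Finset.mem_insert.1 hb with rfl | hbK
      · omega
      · have := hle b hbK; omega
      · exact hokj a haK
      · exact hK a haK b hbK hab
    · rw [Finset.sum_insert hj, hsum]
  -- Here the maximum is the default value `0`, so the chain `{j}` attains the weight.
  · exact hsingle

/-- Remove `j` and apply induction to the rest, a chain ending at its own maximum `i`; `ok i j` is
part of the hypothesis, so transitivity plays no role. -/
theorem sum_le_chainWeight (j : ℕ) (K : Finset ℕ) (hj : j ∈ K) (hle : ∀ i ∈ K, i ≤ j)
    (hK : ∀ i ∈ K, ∀ i' ∈ K, i < i' → ok i i') : ∑ i ∈ K, w i ≤ chainWeight ok w j := by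
  induction j using Nat.strong_induction_on generalizing K with
  | _ j ih =>
  rw [chainWeight_eq, ← Finset.add_sum_erase K w hj]
  refine Nat.add_le_add_left ?_ _
  rcases (K.erase j).eq_empty_or_nonempty with he | hne
  · simp [he]
  have hi := (K.erase j).max'_mem hne
  set i := (K.erase j).max' hne with hidef
  have hiK := Finset.mem_of_mem_erase hi
  have hij : i < j := lt_of_le_of_ne (hle i hiK) (Finset.ne_of_mem_erase hi)
  calc ∑ i ∈ K.erase j, w i
      ≤ chainWeight ok w i := ih i hij _ hi (fun a ha => Finset.le_max' _ _ ha)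
        fun a ha b hb => hK a (Finset.mem_of_mem_erase ha) b (Finset.mem_of_mem_erase hb)
    _ = if ok i j then chainWeight ok w i else 0 := (if_pos (hK i hiK j hj hij)).symm
    _ ≤ _ := Finset.le_sup (f := fun i => if ok i j then chainWeight ok w i else 0)
        (Finset.mem_range.2 hij)

theorem exists_chain_iff (htrans : ∀ i j k, ok i j → ok j k → ok i k) (m t b : ℕ) :
    (∃ K ⊆ Finset.range m, (∀ i ∈ K, ∀ i' ∈ K, i < i' → ok i i') ∧ t ≤ ∑ i ∈ K, w i + b) ↔
      t ≤ (Finset.range m).sup (chainWeight ok w) + b := by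
  constructor
  · rintro ⟨K, hKm, hK, ht⟩
    refine ht.trans (Nat.add_le_add_right ?_ _)
    rcases K.eq_empty_or_nonempty with rfl | hne
    · simp
    · exact (sum_le_chainWeight _ K (K.max'_mem hne) (fun a ha => K.le_max' a ha) hK).trans
        (Finset.le_sup (hKm (K.max'_mem hne)))
  · intro ht
    rcases (Finset.range m).eq_empty_or_nonempty with he | hne
    · exact ⟨∅, by simp, by simp, by simpa [he] using ht⟩
    · obtain ⟨j, hj, hsup⟩ := Finset.exists_mem_eq_sup _ hne (chainWeight ok w)
      obtain ⟨K, -, hle, hK, hsum⟩ := exists_sum_eq_chainWeight (w := w) htrans j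
      refine ⟨K, fun a ha => ?_, hK, by rwa [hsum, ← hsup]⟩
      rw [Finset.mem_range] at hj ⊢
      exact (hle a ha).trans_lt hj

end chainWeight

end RAM

namespace KemenyScore

/-! ### Rankings that agree with the target -/

namespace Ranking

variable {C : Type*} [DecidableEq C]

/-- A head different from `x` and `y` either shifts both indices by one or disappears. -/
theorem idxOf_filter_lt_iff {p : C → Bool} {x y : C} (hx : p x) (hy : p y) (l : List C) :
    (l.filter p).idxOf x < (l.filter p).idxOf y ↔ l.idxOf x < l.idxOf y := by
  induction l with
  | nil => simp
  | cons a l ih =>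
    rcases eq_or_ne a x with rfl | hax <;> rcases eq_or_ne a y with rfl | hay
    · simp
    · simp [hx, hay]
    · simp [hy, hax]
    · by_cases ha : p a <;> simp [ha, hax, hay, ih]

theorem before_restrict_iff {π : Ranking C} {Y : Finset C} {x y : C} :
    (π.restrict Y).Before x y ↔ x ∈ Y ∧ y ∈ Y ∧ π.Before x y := by
  simp only [Before, restrict, List.mem_filter, decide_eq_true_eq]
  constructor
  · rintro ⟨⟨hx, hxY⟩, ⟨hy, hyY⟩, h⟩
    exact ⟨hxY, hyY, hx, hy, (idxOf_filter_lt_iff (by simpa) (by simpa) _).1 h⟩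
  · rintro ⟨hxY, hyY, hx, hy, h⟩
    exact ⟨⟨hx, hxY⟩, ⟨hy, hyY⟩, (idxOf_filter_lt_iff (by simpa) (by simpa) _).2 h⟩

theorem Before.mem_cands {π : Ranking C} {x y : C} (h : π.Before x y) :
    x ∈ π.cands ∧ y ∈ π.cands :=
  ⟨List.mem_toFinset.2 h.1, List.mem_toFinset.2 h.2.1⟩

theorem kendallTau_eq_zero_iff {π ρ : Ranking C} :
    π.kendallTau ρ = 0 ↔ ∀ x y, π.Before x y → ¬ ρ.Before y x := by
  rw [kendallTau, Finset.card_eq_zero, Finset.filter_eq_empty_iff]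
  constructor
  · intro h x y hxy hyx
    exact @h (x, y) (by simp [hxy.mem_cands, hyx.mem_cands]) ⟨hxy, hyx⟩
  · rintro h ⟨x, y⟩ - ⟨hxy, hyx⟩
    exact h x y hxy hyx

end Ranking

namespace CandDelInstance

variable (I : CandDelInstance)

theorem mem_target (x : Fin I.numCand) : x ∈ I.target.order :=
  List.mem_toFinset.1 (show x ∈ I.target.cands from I.target_complete ▸ Finset.mem_univ x)

theorem mem_ranking {R} (hR : R ∈ I.rankings) (x : Fin I.numCand) : x ∈ R.order :=
  List.mem_toFinset.1 (show x ∈ R.cands from I.rankings_complete R hR ▸ Finset.mem_univ x)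

theorem length_order {m : ℕ} {R : Ranking (Fin m)} (hR : R.cands = Finset.univ) :
    R.order.length = m := by
  rw [← List.toFinset_card_of_nodup R.nodup]
  simpa [Ranking.cands] using congrArg Finset.card hR

/-- The threshold is zero: all rankings agree with the target on the remaining candidates. -/
theorem isYes_zero_iff : I.IsYes 0 ↔
    ∃ Y : Finset (Fin I.numCand), ∑ c, I.cost c ≤ ∑ c ∈ Y, I.cost c + I.budget ∧
      ∀ x ∈ Y, ∀ y ∈ Y, I.target.order.idxOf x < I.target.order.idxOf y →
        ∀ R ∈ I.rankings, R.order.idxOf x < R.order.idxOf y := by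
  have key : ∀ Z : Finset (Fin I.numCand),
      (∑ c ∈ Z, I.cost c ≤ I.budget ∧
        (((I.rankings.map fun R => (I.target.restrict Zᶜ).kendallTau (R.restrict Zᶜ)).sum : ℕ) : ℤ)
          ≤ 0) ↔
      (∑ c, I.cost c ≤ ∑ c ∈ Zᶜ, I.cost c + I.budget ∧
        ∀ x ∈ Zᶜ, ∀ y ∈ Zᶜ, I.target.order.idxOf x < I.target.order.idxOf y →
          ∀ R ∈ I.rankings, R.order.idxOf x < R.order.idxOf y) := by
    intro Z
    refine and_congr ?_ ?_
    -- Deleting `Z` within the budget means that the kept cost falls short of the total by at most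
    -- the budget; the additive form avoids subtraction.
    · rw [← Finset.sum_add_sum_compl Z I.cost]
      omega
    · rw [← Nat.cast_zero, Nat.cast_le, Nat.le_zero, List.sum_eq_zero_iff]
      simp only [List.mem_map, forall_exists_index, and_imp, forall_apply_eq_imp_iff₂,
        Ranking.kendallTau_eq_zero_iff, Ranking.before_restrict_iff]
      generalize Zᶜ = Y
      constructor
      · intro h x hx y hy hxy R hR
        by_contra hcon
        -- Distinct candidates have distinct places, so "not `y` before `x`" becomes "`x` before
        -- `y`".
        have hne : R.order.idxOf y ≠ R.order.idxOf x := fun he => by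
          rw [List.idxOf_inj (I.mem_ranking hR y)] at he
          simp [he] at hxy
        exact h R hR x y hx hy ⟨I.mem_target x, I.mem_target y, hxy⟩
          ⟨hy, hx, I.mem_ranking hR y, I.mem_ranking hR x, by omega⟩
      · rintro h R hR x y hx hy ⟨-, -, hxy⟩ ⟨-, -, -, -, hyx⟩
        have := h x hx y hy hxy R hR
        omega
  constructor
  · rintro ⟨Z, hZ⟩
    exact ⟨Zᶜ, (key Z).1 hZ⟩
  · rintro ⟨Y, hY⟩
    exact ⟨Yᶜ, (key Yᶜ).2 (by rwa [compl_compl])⟩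

/-! ### The input word -/

theorem getD_flatten_of_length {m : ℕ} {L : List (List ℕ)} (hL : ∀ l ∈ L, l.length = m) {r a : ℕ}
    (hr : r < L.length) (ha : a < m) : L.flatten.getD (r * m + a) 0 = (L[r]).getD a 0 := by
  induction L generalizing r with
  | nil => simp at hr
  | cons l L ih =>
    have hl : l.length = m := hL l (by simp)
    cases r with
    | zero =>
      rw [List.flatten_cons, List.getD_append _ _ _ _ (by omega)]
      simp
    | succ r =>
      have e : (r + 1) * m + a - m = r * m + a := by rw [add_mul]; omega
      rw [List.flatten_cons, List.getD_append_right _ _ _ _ (by rw [hl, add_mul]; omega), hl, e,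
        ih (fun l' hl' => hL l' (List.mem_cons_of_mem _ hl')) (by simpa using hr)]
      simp

theorem idxOf_map_of_injective {α β : Type*} [DecidableEq α] [DecidableEq β] {f : α → β}
    (hf : Function.Injective f) (l : List α) (a : α) : (l.map f).idxOf (f a) = l.idxOf a := by
  induction l with
  | nil => simp
  | cons b l ih =>
    rcases eq_or_ne b a with rfl | h
    · simp
    · simp [List.idxOf_cons_ne, h, hf.ne h, ih]

variable (I : CandDelInstance)

/-- The candidate at place `j` of the target. -/
def candAt (j : ℕ) : ℕ := (I.target.order.map Fin.val).getD j 0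

/-- The cost of the candidate `c`. -/
def costOf (c : ℕ) : ℕ := (List.ofFn I.cost).getD c 0

/-- The position in the input word of the entry for the candidate `c` in the ranking number `r`. -/
def entryPos (r c : ℕ) : ℕ :=
  3 + I.numCand + I.numCand + r * I.numCand +
    ((I.rankings.map fun R => R.order.map Fin.val).getD r []).idxOf c

theorem candAt_idxOf (x : Fin I.numCand) : I.candAt (I.target.order.idxOf x) = x := by
  have := List.idxOf_lt_length_iff.2 (I.mem_target x)
  rw [candAt, List.getD_eq_getElem _ _ (by simpa using this)]
  simp

theorem costOf_val (x : Fin I.numCand) : I.costOf x = I.cost x := by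
  rw [costOf, List.getD_eq_getElem _ _ (by simp)]
  simp

theorem entryPos_val {r : ℕ} (hr : r < I.rankings.length) (x : Fin I.numCand) :
    I.entryPos r x = 3 + I.numCand + I.numCand + r * I.numCand +
      (I.rankings[r]).order.idxOf x := by
  rw [entryPos, List.getD_eq_getElem _ _ (by simpa using hr), List.getElem_map,
    idxOf_map_of_injective Fin.val_injective]

theorem length_target : I.target.order.length = I.numCand := length_order I.target_complete

theorem getD_cost (j : ℕ) (hj : j < I.numCand) : I.encode.getD (3 + j) 0 = I.costOf j := by
  rw [encode, List.append_assoc, List.append_assoc, List.getD_append_right _ _ _ _ (by simp),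
    List.getD_append _ _ _ _ (by simp; omega), costOf]
  simp

theorem getD_target (j : ℕ) (hj : j < I.numCand) :
    I.encode.getD (3 + I.numCand + j) 0 = I.candAt j := by
  rw [encode, List.append_assoc, List.getD_append_right _ _ _ _ (by simp; omega),
    List.getD_append _ _ _ _ (by simp [I.length_target]; omega), candAt]
  congr 1
  simp
  omega

theorem getD_entry {r a : ℕ} (hr : r < I.rankings.length) (ha : a < I.numCand) :
    I.encode.getD (3 + I.numCand + I.numCand + r * I.numCand + a) 0 =
      ((I.rankings[r]).order[a]'(by
        rwa [length_order (I.rankings_complete _ (List.getElem_mem hr))])).val := by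
  have hlen := fun R hR => length_order (I.rankings_complete R hR)
  have hidx : 3 + I.numCand + I.numCand + r * I.numCand + a -
      ([I.numCand, I.rankings.length, I.budget] ++ List.ofFn I.cost ++
        I.target.order.map Fin.val).length = r * I.numCand + a := by
    simp [I.length_target]
    omega
  rw [encode, List.getD_append_right _ _ _ _ (by simp [I.length_target]; omega), hidx,
    List.flatMap_def, getD_flatten_of_length (by simpa using hlen) (by simpa using hr) ha,
    List.getD_eq_getElem _ _ (by simpa [hlen _ (List.getElem_mem hr)] using ha)]
  simp

theorem encodes_encode :
    RAM.Encodes I.encode I.numCand I.rankings.length I.budget I.candAt I.costOf I.entryPos where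
  numCand := rfl
  numRankings := rfl
  budget := rfl
  cost_eq := I.getD_cost
  cand_eq := I.getD_target
  cand_lt j hj := by
    rw [candAt, List.getD_eq_getElem _ _ (by simpa [I.length_target] using hj)]
    simp
  entry_lt r hr a ha := by
    rw [I.getD_entry hr ha]
    exact Fin.is_lt _
  pos_entry r hr a ha := by
    rw [I.getD_entry hr ha, I.entryPos_val hr, List.Nodup.idxOf_getElem (Ranking.nodup _)]
  exists_entry r hr c hc := by
    have hR := List.getElem_mem hr
    have h := (List.idxOf_lt_length_iff.2 (I.mem_ranking hR ⟨c, hc⟩)).trans_eq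
      (length_order (I.rankings_complete _ hR))
    refine ⟨_, h, ?_⟩
    rw [I.getD_entry hr h]
    simp

theorem idxOf_target_injective : Function.Injective fun x => I.target.order.idxOf x :=
  fun x _ h => (List.idxOf_inj (I.mem_target x)).1 h

/-- Places and candidates correspond bijectively, so sets of places in `range` are exactly the
images of candidate sets. -/
theorem image_idxOf_target :
    (Finset.univ.image fun x => I.target.order.idxOf x) = Finset.range I.numCand := by
  refine Finset.eq_of_subset_of_card_le (fun j hj => ?_) ?_
  · obtain ⟨x, -, rfl⟩ := Finset.mem_image.1 hj
    exact Finset.mem_range.2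
      ((List.idxOf_lt_length_iff.2 (I.mem_target x)).trans_eq I.length_target)
  · rw [Finset.card_image_of_injective _ I.idxOf_target_injective]
    simp

/-- The table holds absolute input positions; within one ranking the common offset cancels, leaving
the comparison of ranks. -/
theorem allPrefer_iff (x y : Fin I.numCand) :
    RAM.AllPrefer I.rankings.length I.candAt I.entryPos (I.target.order.idxOf x)
      (I.target.order.idxOf y) ↔ ∀ R ∈ I.rankings, R.order.idxOf x < R.order.idxOf y := by
  simp only [RAM.AllPrefer, candAt_idxOf, List.forall_mem_iff_forall_getElem]
  refine forall₂_congr fun r hr => ?_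
  rw [I.entryPos_val hr, I.entryPos_val hr]
  exact Nat.add_lt_add_iff_left

theorem sum_image_idxOf_target (Y : Finset (Fin I.numCand)) :
    ∑ i ∈ Y.image (fun x => I.target.order.idxOf x), I.costOf (I.candAt i) =
      ∑ c ∈ Y, I.cost c := by
  rw [Finset.sum_image I.idxOf_target_injective.injOn]
  simp only [candAt_idxOf, costOf_val]

theorem isYes_zero_iff_chainCost : I.IsYes 0 ↔
    ∑ i ∈ Finset.range I.numCand, I.costOf (I.candAt i) ≤
      (Finset.range I.numCand).sup
        (RAM.chainCost I.rankings.length I.candAt I.costOf I.entryPos) + I.budget := by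
  rw [isYes_zero_iff, ← RAM.exists_chain_iff
    (fun i j k h h' r hr => (h r hr).trans (h' r hr)), ← image_idxOf_target,
    sum_image_idxOf_target]
  constructor
  · rintro ⟨Y, hsum, hY⟩
    refine ⟨Y.image fun x => I.target.order.idxOf x, Finset.image_subset_image Y.subset_univ, ?_,
      by rwa [sum_image_idxOf_target]⟩
    simp only [Finset.forall_mem_image]
    exact fun x hx y hy hxy => (I.allPrefer_iff x y).2 (hY x hx y hy hxy)
  · rintro ⟨K, hKm, hK, hsum⟩
    obtain ⟨Y, -, rfl⟩ := Finset.subset_image_iff.1 hKm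
    rw [sum_image_idxOf_target] at hsum
    simp only [Finset.forall_mem_image] at hK
    exact ⟨Y, hsum, fun x hx y hy hxy => (I.allPrefer_iff x y).1 (hK hx hy hxy)⟩

/-- Keeping all candidates works; this justifies the early exits of the program. -/
theorem isYes_zero_of_trivial (h : I.numCand = 0 ∨ I.rankings.length = 0) : I.IsYes 0 := by
  rw [isYes_zero_iff]
  refine ⟨Finset.univ, Nat.le_add_right _ _, fun x _ y _ _ R hR => ?_⟩
  rcases h with h | h
  · exact absurd x.is_lt (by omega)
  · simp [List.length_eq_zero_iff.1 h] at hR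

theorem length_encode :
    I.encode.length = 3 + I.numCand + I.numCand + I.rankings.length * I.numCand := by
  have : (I.rankings.map fun R => R.order.length) = I.rankings.map fun _ => I.numCand :=
    List.map_congr_left fun R hR => length_order (I.rankings_complete R hR)
  simp [encode, I.length_target, List.length_flatMap, this]
  omega

end CandDelInstance

end KemenyScore

/-! ### Bit length of the input and the final bounds -/

namespace RAM

theorem length_le_inputLength (x : List ℕ) : x.length ≤ inputLength x := by
  induction x with
  | nil => simp
  | cons a x ih => simp [inputLength] at *; omega

theorem size_getD_le_inputLength (x : List ℕ) (k : ℕ) : (x.getD k 0).size ≤ inputLength x := by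
  induction x generalizing k with
  | nil => simp
  | cons a x ih =>
    cases k with
    | zero => simp [inputLength]; omega
    | succ k => have := ih k; simp [inputLength] at *; omega

end RAM

theorem mainTheorem5 :
    ∃ (p : RAM.Program) (q : Polynomial ℕ) (K : ℕ),
      ∀ I : KemenyScore.CandDelInstance,
        ∃ (steps time : ℕ) (answer : Bool),
          RAM.Halts p I.encode steps time answer ∧
          (answer = true ↔ I.IsYes 0) ∧
          time ≤ q.eval (RAM.inputLength I.encode) ∧
          steps ≤ K * (I.rankings.length * I.numCand ^ 2 + 1) := by
  -- The polynomial is the cost bound `steps * (1 + 2 * (B + steps))` with `B = X + 10` and `steps`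
  -- replaced by `100 * (X ^ 2 + 1)`.
  refine ⟨RAM.chainProgram, 100 * (Polynomial.X ^ 2 + 1) *
    (1 + 2 * (Polynomial.X + 10 + 100 * (Polynomial.X ^ 2 + 1))), 100, fun I => ?_⟩
  obtain ⟨steps, time, answer, hhalts, hsteps, hans⟩ := RAM.halts_chainProgram I.encodes_encode
  refine ⟨steps, time, answer, hhalts, ?_, ?_, hsteps⟩
  · rw [hans, ← I.isYes_zero_iff_chainCost]
    have := I.isYes_zero_of_trivial
    tauto
  · set L := RAM.inputLength I.encode with hL
    have hlen := (I.length_encode ▸ RAM.length_le_inputLength I.encode : _ ≤ L)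
    have hsteps' : steps ≤ 100 * (L ^ 2 + 1) := by
      -- The word contains all `n * m` ranking entries and the `m` costs, so both numbers are at
      -- most `L` and `n * m ^ 2 ≤ L ^ 2`.
      have h := Nat.mul_le_mul (show I.rankings.length * I.numCand ≤ L by omega)
        (show I.numCand ≤ L by omega)
      nlinarith
    have htime : time ≤ steps * (1 + 2 * (L + 10 + steps)) := by
      refine hhalts.time_le (B := L + 10) ?_
        (fun k => (RAM.size_getD_le_inputLength _ k).trans (by omega))
        (fun i => by simp [RAM.Config.init])
      intro i c hc
      -- The constants of the program are at most `20`, so ten bits are ample.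
      refine le_trans (b := 10) (Nat.size_le.2 ?_) (by omega)
      simp [RAM.chainProgram] at hc
      omega
    simp only [Polynomial.eval_mul, Polynomial.eval_add, Polynomial.eval_pow, Polynomial.eval_X,
      Polynomial.eval_one, Polynomial.eval_ofNat]
    exact htime.trans (Nat.mul_le_mul hsteps' (by omega))
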